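/- \textbf{Theorem (SG dominance theorem).} \emph{Conventions.} Let $\mathbb{C}_+$ and $\bar{\mathbb{C}}_+$ be the open and closed right half-planes. For a square matrix $G$ of real-rational functions, poles are counted with McMillan multiplicity: the multiplicity of $s\in\mathbb{C}$ as a pole of $G$ is the largest order that $s$ has as a pole of any minor of $G$. Let $\mathcal{RL}_\infty^{m\times m}$ be the set of $m\times m$ real-rational proper matrices with no poles on $j\mathbb{R}$; $G\in\mathcal{RL}_\infty^{m\times m}$ is called $p$-dominant if it has exactly $p$ poles in $\mathbb{C}_+$. For $\omega=\pm\infty$, $G(j\omega)$ means $G(\infty)=\lim_{|s|\to\infty}G(s)$. For nonzero $x,y\in\mathbb{C}^m$ let $\gamma(x,y)=\|y\|_2/\|x\|_2$ and $\theta(x,y)=\arccos\frac{\mathrm{Re}(x^*y)}{\|x\|_2\|y\|_2}\in[0,\pi]$. For $A\in\mathbb{C}^{m\times m}$ the scaled graph and the inverse scaled graph are $$\mathrm{SG}(A)=\{\gamma(x,Ax)e^{\pm j\theta(x,Ax)} : x\in\mathbb{C}^m,\ x\neq0,\ Ax\ne 0\},\qquad \mathrm{SG}^\dagger(A)=\{\gamma(Ax,x)e^{\pm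 j\theta(Ax,x)} : x\in\mathbb{C}^m,\ x\neq0,\ Ax\neq0\}.$$ The positive feedback system $P\#C$ of $P,C\in\mathcal{RL}_\infty^{m\times m}$ is called $p$-dominant if it is well-posed, i.e. $I-P(\infty)C(\infty)$ has full rank, and the transfer matrix $\begin{bmatrix} I&-C\\-P&I\end{bmatrix}^{-1}$ belongs to $\mathcal{RL}_\infty^{2m\times2m}$ and is $p$-dominant. It has no unstable pole-zero cancellation if the number of poles of $PC$ in $\bar{\mathbb{C}}_+$ equals the sum of the number of poles of $P$ in $\bar{\mathbb{C}}_+$ and the number of poles of $C$ in $\bar{\mathbb{C}}_+$. \emph{Statement.} Let $P\in\mathcal{RL}_\infty^{m\times m}$ be $p_1$-dominant and let $C\in\mathcal{RL}_\infty^{m\times m}$ be $p_2$-dominant. Suppose that there is no unstable pole-zero cancellation in $P\#C$. If $$\mathrm{SG}(\tau P(j\omega))\cap\mathrm{SG}^\dagger(C(j\omega))=\emptyset\qquad\text{for all }\omega\in[-\infty,\infty]\text{ and all }\tau\in(0,1],$$ then $P\#C$ is $(p_1+p_2)$-dominant. -/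

import Mathlib

noncomputable section

namespace LTI

/-! ### Gains, phases and scaled graphs of complex matrices -/

/-- The action `x ↦ A x` of a complex matrix on `ℂᵐ` with its Euclidean norm. -/
def apply {m : ℕ} (A : Matrix (Fin m) (Fin m) ℂ) (x : EuclideanSpace ℂ (Fin m)) :
    EuclideanSpace ℂ (Fin m) :=
  WithLp.toLp 2 (Matrix.mulVec A x.ofLp)

/-- The gain `‖y‖₂ / ‖x‖₂` from `x` to `y` (only used for `x ≠ 0`, where it is finite). -/
def gain {m : ℕ} (x y : EuclideanSpace ℂ (Fin m)) : ℝ :=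
  ‖y‖ / ‖x‖

/-- The phase `arccos (Re (x^* y) / (‖x‖₂ ‖y‖₂)) ∈ [0, π]` from `x` to `y`
(only used for `x ≠ 0` and `y ≠ 0`). -/
def phase {m : ℕ} (x y : EuclideanSpace ℂ (Fin m)) : ℝ :=
  Real.arccos ((inner ℂ x y).re / (‖x‖ * ‖y‖))

/-- The scaled graph of `A`. Since `x ≠ 0` and `A x ≠ 0`, all its points are finite. -/
def scaledGraph {m : ℕ} (A : Matrix (Fin m) (Fin m) ℂ) : Set ℂ :=
  {z | ∃ x : EuclideanSpace ℂ (Fin m), x ≠ 0 ∧ apply A x ≠ 0 ∧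
    (z = gain x (apply A x) * Complex.exp (Complex.I * phase x (apply A x)) ∨
     z = gain x (apply A x) * Complex.exp (-(Complex.I * phase x (apply A x))))}

/-- The inverse scaled graph of `A`: the roles of input and output are swapped. -/
def invScaledGraph {m : ℕ} (A : Matrix (Fin m) (Fin m) ℂ) : Set ℂ :=
  {z | ∃ x : EuclideanSpace ℂ (Fin m), x ≠ 0 ∧ apply A x ≠ 0 ∧
    (z = gain (apply A x) x * Complex.exp (Complex.I * phase (apply A x) x) ∨
     z = gain (apply A x) x * Complex.exp (-(Complex.I * phase (apply A x) x)))}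

/-! ### Real-rational transfer matrices and their poles -/

section Poles

variable {ι : Type*} [Fintype ι]

/-- The minors of `G` are indexed by a size `k ≤ card ι` together with a choice of `k` rows and
`k` columns. Choices with a repetition give the minor `0`, and permuting a choice changes at most
the sign, so this lists all minors, including the empty minor `1`. -/
abbrev MinorIndex (ι : Type*) [Fintype ι] : Type _ :=
  Σ k : Fin (Fintype.card ι + 1), (Fin k → ι) × (Fin k → ι)

/-- The minor of `G` with the given rows and columns. -/
def minor (G : Matrix ι ι (RatFunc ℝ)) (x : MinorIndex ι) : RatFunc ℝ :=
  (G.submatrix x.2.1 x.2.2).det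

/-- The order of `s` as a pole of the scalar rational function `f` (`0` if `s` is not a pole). -/
def poleOrder (f : RatFunc ℝ) (s : ℂ) : ℕ :=
  (f.denom.map (algebraMap ℝ ℂ)).rootMultiplicity s

/-- The (McMillan) multiplicity of `s` as a pole of the transfer matrix `G`: the largest order that
`s` has as a pole of any minor of `G`. Equivalently, the multiplicity of `s` as a root of the pole
polynomial of `G`, the least common denominator of all minors of `G`. It is `0` if and only if `s`
is not a pole of `G`. -/
def poleMult (G : Matrix ι ι (RatFunc ℝ)) (s : ℂ) : ℕ :=
  Finset.univ.sup fun x : MinorIndex ι => poleOrder (minor G x) s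

/-- A transfer matrix has finitely many poles. -/
theorem finite_support_poleMult (G : Matrix ι ι (RatFunc ℝ)) :
    (Function.support (poleMult G)).Finite := by
  classical
  refine (Set.finite_iUnion fun x : MinorIndex ι =>
    (((minor G x).denom.map (algebraMap ℝ ℂ)).roots.toFinset.finite_toSet)).subset ?_
  intro s hs
  have h0 : 0 < poleMult G s := Nat.pos_of_ne_zero hs
  obtain ⟨x, -, hx⟩ := (Finset.lt_sup_iff).1 h0
  have hne : (minor G x).denom.map (algebraMap ℝ ℂ) ≠ 0 :=
    (Polynomial.map_ne_zero_iff (algebraMap ℝ ℂ).injective).2 (RatFunc.denom_ne_zero _)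
  refine Set.mem_iUnion.2 ⟨x, ?_⟩
  simpa [hne] using (Polynomial.rootMultiplicity_pos hne).1 hx

/-- The number of poles of `G` in the region `S`, counted with (McMillan) multiplicity. -/
def numPoles (G : Matrix ι ι (RatFunc ℝ)) (S : Set ℂ) : ℕ :=
  ∑ᶠ s ∈ S, poleMult G s

/-- The open right half-plane. -/
def openRHP : Set ℂ := {s | 0 < s.re}

/-- The closed right half-plane. -/
def closedRHP : Set ℂ := {s | 0 ≤ s.re}

/-- A transfer matrix is proper if in each entry the degree of the numerator is at most the degree
of the denominator. -/
def IsProper (G : Matrix ι ι (RatFunc ℝ)) : Prop :=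
  ∀ i j, (G i j).num.degree ≤ (G i j).denom.degree

/-- `G` belongs to `RL∞`: it is a (real-rational) proper transfer matrix without poles on the
imaginary axis. -/
def IsRLInfty (G : Matrix ι ι (RatFunc ℝ)) : Prop :=
  IsProper G ∧ ∀ s : ℂ, s.re = 0 → poleMult G s = 0

/-- `G` is `p`-dominant: it belongs to `RL∞` and has exactly `p` poles in the open right
half-plane. -/
def IsDominant (G : Matrix ι ι (RatFunc ℝ)) (p : ℕ) : Prop :=
  IsRLInfty G ∧ numPoles G openRHP = p

/-- The value `f(∞)` of a proper rational function `f`; the denominator `f.denom` is monic. -/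
def valueAtInfty (f : RatFunc ℝ) : ℝ :=
  f.num.coeff f.denom.natDegree

/-- The frequency response `G(jω)` of `G` at a frequency `ω ∈ [-∞, ∞]`, with value `G(∞)` at
`ω = ±∞`. -/
def freqResp (G : Matrix ι ι (RatFunc ℝ)) : EReal → Matrix ι ι ℂ
  | ⊥ => Matrix.of fun i j => (valueAtInfty (G i j) : ℂ)
  | ⊤ => Matrix.of fun i j => (valueAtInfty (G i j) : ℂ)
  | (ω : ℝ) => Matrix.of fun i j =>
      RatFunc.eval (algebraMap ℝ ℂ) (Complex.I * (ω : ℂ)) (G i j)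

end Poles

/-! ### The positive feedback system `P # C` -/

section Feedback

variable {m : ℕ}

/-- The number of poles of `P C` in the closed right half-plane is the sum of that of `P` and that
of `C`. -/
def NoUnstableCancellation (P C : Matrix (Fin m) (Fin m) (RatFunc ℝ)) : Prop :=
  numPoles (P * C) closedRHP = numPoles P closedRHP + numPoles C closedRHP

/-- The feedback system is well-posed: `I - P(∞) C(∞)` has full rank. -/
def IsWellPosed (P C : Matrix (Fin m) (Fin m) (RatFunc ℝ)) : Prop :=
  IsUnit (1 - freqResp P ⊤ * freqResp C ⊤)

/-- The closed-loop transfer matrix from `(w₁, w₂)` to `(u₁, u₂)`, the inverse of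
`[I, -C; -P, I]`. -/
def closedLoop (P C : Matrix (Fin m) (Fin m) (RatFunc ℝ)) :
    Matrix (Fin m ⊕ Fin m) (Fin m ⊕ Fin m) (RatFunc ℝ) :=
  (Matrix.fromBlocks 1 (-C) (-P) 1)⁻¹

/-- The feedback system `P # C` is `p`-dominant. -/
def IsFeedbackDominant (P C : Matrix (Fin m) (Fin m) (RatFunc ℝ)) (p : ℕ) : Prop :=
  IsWellPosed P C ∧ IsDominant (closedLoop P C) p

end Feedback

end LTI

end

/-!
The zeros of `det (I - P C)` in the right half-plane are compared with its poles by a homotopy, and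
the poles of the closed loop are read off from the minors of `[I, -C; -P, I]`.

*From scaled graphs to determinants.* If `τ P(jω) C(jω)` fixed a vector `u ≠ 0`, then `C(jω) u` and
`u` would give a common point of `SG(τ P(jω))` and `SG†(C(jω))`. Hence
`det (I - τ P(jω) C(jω)) ≠ 0` for all `ω ∈ [-∞, ∞]` and `τ ∈ [0, 1]`
(`det_one_sub_ne_zero_of_disjoint`). For `ω = ∞`, `τ = 1` this is well-posedness.

*Homotopy.* Over a common denominator `d` without roots on the imaginary axis,
`det (I - τ P C)` has a numerator `N_τ` (`loopNumerator`) whose coefficients are continuous in `τ`,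
whose degree is constant (the condition at `ω = ∞`), and which has no root on the imaginary axis
(the condition at finite `ω`). Its roots therefore cannot leave or enter the right half-plane
(`countP_roots_re_pos_eq`), so `N_1` has as many of them there as `N_0`, which is the denominator of
`det (I - P C) = N_1 / N_0`.

*Poles of the closed loop.* Let `v` be the valuation of the field of rational functions at a point.
Up to sign, the minors of a square matrix `G` are the maximal minors of the wide matrix `[I  G]`
(`maxMinor_fromCols_one`), so the multiplicity of a pole is the largest value of a maximal minor of
`[I  G]`. This largest value is multiplied by `v (det A)` under left multiplication by `A`, and is
unchanged by column operations invertible over the valuation ring, because dividing by a maximal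
minor of largest value leaves entries in the valuation ring (`exists_integral_factorization`).
Applied to `[I  H⁻¹] = H⁻¹ [H  I]` with `H = [I, -C; -P, I]`, this gives, at every point,
`mult(closed loop) = mult(P) + mult(C) + ord (det (I - P C))`
(`maxMinor_fromCols_one_closedLoop`, `poleMult_closedLoop_add`). Summing over the right half-plane,
the last term contributes zero by the homotopy argument.
-/

/-! ### Valuations of maximal minors and the closed loop -/

namespace LTI

open Matrix

section MaxMinor

variable {K Γ : Type*} [Field K] [LinearOrderedCommGroupWithZero Γ] (v : Valuation K Γ)
variable {ι ι' κ κ' : Type*}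

theorem submatrix_mul_cols [Fintype ι] (T : Matrix ι ι K) (W : Matrix ι κ K) (c : ι → κ) :
    (T * W).submatrix id c = T * W.submatrix id c := by
  ext i j; simp [mul_apply]

theorem valuation_one_apply_le_one [DecidableEq ι] (i j : ι) : v ((1 : Matrix ι ι K) i j) ≤ 1 := by
  rw [one_apply]; split_ifs <;> simp

theorem valuation_fromBlocks_one_le_one [DecidableEq ι] {A B : Matrix ι ι K}
    (hA : ∀ i j, v (A i j) ≤ 1) (hB : ∀ i j, v (B i j) ≤ 1) (i j : ι ⊕ ι) :
    v (fromBlocks 1 A 0 B i j) ≤ 1 := by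
  rcases i with i | i <;> rcases j with j | j <;> simp [hA, hB, valuation_one_apply_le_one]

theorem valuation_mul_apply_le_one [Fintype κ] {A : Matrix ι κ K} {B : Matrix κ κ' K}
    (hA : ∀ i j, v (A i j) ≤ 1) (hB : ∀ i j, v (B i j) ≤ 1) (i : ι) (j : κ') :
    v ((A * B) i j) ≤ 1 := by
  rw [mul_apply]
  refine v.map_sum_le fun k _ => ?_
  rw [map_mul]
  exact mul_le_one' (hA _ _) (hB _ _)

theorem valuation_det_submatrix_le_sup [Fintype ι] (G : Matrix ι ι K) {k : ℕ}
    (hk : k ≤ Fintype.card ι) (r d : Fin k → ι) : v (G.submatrix r d).det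
      ≤ Finset.univ.sup fun x : MinorIndex ι => v (G.submatrix x.2.1 x.2.2).det :=
  Finset.le_sup (f := fun x : MinorIndex ι => v (G.submatrix x.2.1 x.2.2).det)
    (Finset.mem_univ (⟨⟨k, Nat.lt_succ_of_le hk⟩, r, d⟩ : MinorIndex ι))

variable [Fintype ι] [DecidableEq ι] [Fintype ι'] [DecidableEq ι']

theorem valuation_sign_mul (σ : Equiv.Perm ι) (x : K) :
    v (((Equiv.Perm.sign σ : ℤ) : K) * x) = v x := by
  rcases Int.units_eq_one_or (Equiv.Perm.sign σ) with h | h <;> simp [h]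

/-- A determinant with entries in the valuation ring lies in the valuation ring. -/
theorem valuation_det_le_one {A : Matrix ι ι K} (h : ∀ i j, v (A i j) ≤ 1) : v A.det ≤ 1 := by
  rw [det_apply']
  refine v.map_sum_le fun σ _ => ?_
  rw [valuation_sign_mul, map_prod]
  exact Finset.prod_le_one' fun i _ => h _ _

/-- A maximal minor of `[I  G]` using the `i`-th unit vector as `i`-th column for each `i` outside
`p` is the minor of `G` with rows in `p` and the remaining chosen columns. -/
theorem det_fromCols_one_submatrix (G : Matrix ι κ K) (p : ι → Prop) [DecidablePred p]
    {n : Type*} [Fintype n] [DecidableEq n] (r : n ≃ {i // p i}) (d : n → κ) (c : ι → ι ⊕ κ)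
    (hl : ∀ i, ¬ p i → c i = Sum.inl i) (hr : ∀ j, c (r j) = Sum.inr (d j)) :
    ((fromCols (1 : Matrix ι ι K) G).submatrix id c).det
      = (G.submatrix (fun j => (r j : ι)) d).det := by
  rw [twoBlockTriangular_det' _ p]
  · have h1 : toSquareBlockProp ((fromCols (1 : Matrix ι ι K) G).submatrix id c)
        (fun i => ¬ p i) = 1 := by
      ext i j
      simp [toSquareBlockProp_def, hl j j.2, one_apply, Subtype.ext_iff]
    rw [h1, det_one, mul_one, ← det_submatrix_equiv_self r]
    congr 1
    ext i j
    simp [toSquareBlockProp_def, hr]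
  · intro i hi j hj
    have : i ≠ j := fun h => hj (h ▸ hi)
    simp [hl j hj, this]

variable [Fintype κ] [Fintype κ']

/-- The largest value of a maximal (full-row) minor of a wide matrix, with respect to a
multiplicatively written valuation. The columns are chosen by arbitrary functions `ι → κ`; choices
with a repetition contribute the minor `0`. -/
def maxMinor (M : Matrix ι κ K) : Γ :=
  Finset.univ.sup fun c : ι → κ => v (M.submatrix id c).det

theorem le_maxMinor (M : Matrix ι κ K) (c : ι → κ) :
    v (M.submatrix id c).det ≤ maxMinor v M :=
  Finset.le_sup (f := fun c : ι → κ => v (M.submatrix id c).det) (Finset.mem_univ c)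

theorem maxMinor_le {M : Matrix ι κ K} {γ : Γ} (h : ∀ c : ι → κ, v (M.submatrix id c).det ≤ γ) :
    maxMinor v M ≤ γ :=
  Finset.sup_le fun c _ => h c

/-- If `M = T W` where `W` has entries in the valuation ring and contains an identity matrix, then
`det T` has the largest value among the maximal minors of `M`. -/
theorem maxMinor_mul_of_integral {T : Matrix ι ι K} {W : Matrix ι κ K} {c : ι → κ}
    (hW : ∀ i j, v (W i j) ≤ 1) (hc : W.submatrix id c = 1) :
    maxMinor v (T * W) = v T.det := by
  refine le_antisymm (maxMinor_le v fun d => ?_) ?_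
  · rw [submatrix_mul_cols, det_mul, map_mul]
    exact mul_le_of_le_one_right' (valuation_det_le_one v fun i j => hW _ _)
  · have := le_maxMinor v (T * W) c
    rwa [submatrix_mul_cols, hc, mul_one] at this

/-- Factoring out a maximal minor of largest value: by Cramer's rule the remaining factor has
entries in the valuation ring. -/
theorem exists_integral_factorization {M : Matrix ι κ K} (hM : maxMinor v M ≠ 0) :
    ∃ (T : Matrix ι ι K) (W : Matrix ι κ K) (c : ι → κ), M = T * W ∧
      (∀ i j, v (W i j) ≤ 1) ∧ W.submatrix id c = 1 := by
  have hne : (Finset.univ : Finset (ι → κ)).Nonempty := by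
    by_contra h
    rw [Finset.not_nonempty_iff_eq_empty] at h
    exact hM (by rw [maxMinor, h, Finset.sup_empty, bot_eq_zero])
  obtain ⟨c, -, hc⟩ := Finset.exists_mem_eq_sup _ hne
    (fun c : ι → κ => v (M.submatrix id c).det)
  change maxMinor v M = _ at hc
  have hv : v (M.submatrix id c).det ≠ 0 := hc ▸ hM
  have hdet : (M.submatrix id c).det ≠ 0 := (v.ne_zero_iff).1 hv
  have hu : IsUnit (M.submatrix id c).det := isUnit_iff_ne_zero.2 hdet
  refine ⟨M.submatrix id c, (M.submatrix id c)⁻¹ * M, c, ?_, fun i j => ?_, ?_⟩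
  · rw [mul_nonsing_inv_cancel_left _ _ hu]
  · have key : ((M.submatrix id c)⁻¹ * M) i j
        = (M.submatrix id c).det⁻¹ * (M.submatrix id (Function.update c i j)).det := by
      have h1 : M.submatrix id (Function.update c i j)
          = (M.submatrix id c).updateCol i (fun k => M k j) := by
        ext a b
        by_cases hb : b = i
        · subst hb; simp
        · simp [hb]
      rw [h1, ← cramer_apply, cramer_eq_adjugate_mulVec, inv_def, Ring.inverse_eq_inv', smul_mul]
      rfl
    rw [key, map_mul, map_inv₀]
    refine (inv_mul_le_one₀ (zero_lt_iff.2 hv)).2 ?_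
    rw [← hc]
    exact le_maxMinor v M _
  · rw [submatrix_mul_cols, nonsing_inv_mul _ hu]

theorem maxMinor_mul_left (A : Matrix ι ι K) (M : Matrix ι κ K) :
    maxMinor v (A * M) = v A.det * maxMinor v M := by
  have h : maxMinor v (A * M) = Finset.univ.sup fun c : ι → κ =>
      v A.det * v (M.submatrix id c).det := by
    simp only [maxMinor, submatrix_mul_cols, det_mul, map_mul]
  rw [h]
  refine le_antisymm (Finset.sup_le fun c _ => mul_le_mul_right (le_maxMinor v M c) _) ?_
  rcases (Finset.univ : Finset (ι → κ)).eq_empty_or_nonempty with he | hne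
  · simp [maxMinor, he, bot_eq_zero]
  · obtain ⟨c, -, hc⟩ := Finset.exists_mem_eq_sup _ hne
      (fun c : ι → κ => v (M.submatrix id c).det)
    rw [maxMinor, hc]
    exact Finset.le_sup (f := fun c : ι → κ => v A.det * v (M.submatrix id c).det)
      (Finset.mem_univ c)

theorem maxMinor_mul_right_le {M : Matrix ι κ K} (hM : maxMinor v M ≠ 0) {U : Matrix κ κ' K}
    (hU : ∀ i j, v (U i j) ≤ 1) : maxMinor v (M * U) ≤ maxMinor v M := by
  obtain ⟨T, W, c, rfl, hW, hc⟩ := exists_integral_factorization v hM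
  rw [maxMinor_mul_of_integral v hW hc]
  refine maxMinor_le v fun d => ?_
  rw [Matrix.mul_assoc, submatrix_mul_cols, det_mul, map_mul]
  exact mul_le_of_le_one_right' (valuation_det_le_one v fun i j =>
    valuation_mul_apply_le_one v hW hU _ _)

/-- Column operations that are invertible over the valuation ring preserve the largest value of a
maximal minor. -/
theorem maxMinor_mul_right [DecidableEq κ] {M : Matrix ι κ K} (hM : maxMinor v M ≠ 0)
    {U : Matrix κ κ' K} {U' : Matrix κ' κ K} (hMU : maxMinor v (M * U) ≠ 0)
    (hU : ∀ i j, v (U i j) ≤ 1) (hU' : ∀ i j, v (U' i j) ≤ 1) (h : U * U' = 1) :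
    maxMinor v (M * U) = maxMinor v M := by
  have h1 : M * U * U' = M := by rw [Matrix.mul_assoc, h, Matrix.mul_one]
  refine le_antisymm (maxMinor_mul_right_le v hM hU) ?_
  conv_lhs => rw [← h1]
  exact maxMinor_mul_right_le v hMU hU'

theorem maxMinor_submatrix_equiv (M : Matrix ι κ K) (e : κ' ≃ κ) :
    maxMinor v (M.submatrix id e) = maxMinor v M := by
  refine le_antisymm (maxMinor_le v fun c => ?_) (maxMinor_le v fun c => ?_)
  · exact le_maxMinor v M (e ∘ c)
  · have := le_maxMinor v (M.submatrix id e) (e.symm ∘ c)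
    rwa [submatrix_submatrix, ← Function.comp_assoc, e.self_comp_symm] at this

theorem maxMinor_fromBlocks_diagonal {M : Matrix ι κ K} {N : Matrix ι' κ' K}
    (hM : maxMinor v M ≠ 0) (hN : maxMinor v N ≠ 0) :
    maxMinor v (fromBlocks M 0 0 N) = maxMinor v M * maxMinor v N := by
  obtain ⟨T, W, c, rfl, hW, hc⟩ := exists_integral_factorization v hM
  obtain ⟨T', W', c', rfl, hW', hc'⟩ := exists_integral_factorization v hN
  have h : fromBlocks (T * W) 0 0 (T' * W') = fromBlocks T 0 0 T' * fromBlocks W 0 0 W' := by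
    simp [fromBlocks_multiply]
  rw [maxMinor_mul_of_integral v hW hc, maxMinor_mul_of_integral v hW' hc', h,
    maxMinor_mul_of_integral v (c := Sum.map c c'), det_fromBlocks_zero₂₁, map_mul]
  · rintro (i | i) (j | j) <;> simp [hW, hW']
  · rw [← fromBlocks_one, ← hc, ← hc']
    ext (i | i) (j | j) <;> simp

/-- The matrix `[I  G]` has the identity matrix as a maximal minor. -/
theorem one_le_maxMinor_fromCols_one (G : Matrix ι κ K) :
    1 ≤ maxMinor v (fromCols (1 : Matrix ι ι K) G) := by
  have := le_maxMinor v (fromCols (1 : Matrix ι ι K) G) Sum.inl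
  have h : (fromCols (1 : Matrix ι ι K) G).submatrix id Sum.inl = 1 := by ext i j; simp
  rwa [h, det_one, map_one] at this

theorem maxMinor_fromCols_one_ne_zero (G : Matrix ι κ K) :
    maxMinor v (fromCols (1 : Matrix ι ι K) G) ≠ 0 :=
  (zero_lt_one.trans_le (one_le_maxMinor_fromCols_one v G)).ne'

/-- The maximal minors of `[I  G]` are, up to sign, the minors of `G`. -/
theorem maxMinor_fromCols_one (G : Matrix ι ι K) :
    maxMinor v (fromCols (1 : Matrix ι ι K) G)
      = Finset.univ.sup fun x : MinorIndex ι => v (G.submatrix x.2.1 x.2.2).det := by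
  classical
  refine le_antisymm (maxMinor_le v fun c => ?_) (Finset.sup_le ?_)
  · by_cases hc : Function.Injective c
    · let e : {i // ∃ a, c i = Sum.inl a} ≃ {a // ∃ i, c i = Sum.inl a} :=
        Equiv.ofBijective (fun i => ⟨i.2.choose, i, i.2.choose_spec⟩) ⟨by
          rintro ⟨i, hi⟩ ⟨j, hj⟩ h
          refine Subtype.ext (hc ?_)
          have h' : hi.choose = hj.choose := congrArg Subtype.val h
          have h1 := hi.choose_spec
          have h2 := hj.choose_spec
          simp only
          rw [h1, h2, h'], by
          rintro ⟨a, i, hi⟩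
          refine ⟨⟨i, a, hi⟩, Subtype.ext ?_⟩
          have h1 := (⟨a, hi⟩ : ∃ a, c i = Sum.inl a).choose_spec
          exact Sum.inl_injective (h1.symm.trans hi)⟩
      -- permute the columns so that each chosen unit vector stands in its own column
      let σ : Equiv.Perm ι := e.extendSubtype
      let p : ι → Prop := fun a => ¬ ∃ i, c i = Sum.inl a
      have hl : ∀ a, ¬ p a → (c ∘ σ.symm) a = Sum.inl a := by
        intro a ha
        obtain ⟨i, hi⟩ := not_not.1 ha
        have hσ : σ i = a := by
          have h1 : σ i = e ⟨i, a, hi⟩ := e.extendSubtype_apply_of_mem i ⟨a, hi⟩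
          rw [h1]
          exact Sum.inl_injective
            ((⟨a, hi⟩ : ∃ a, c i = Sum.inl a).choose_spec.symm.trans hi)
        simp [← hσ, hi]
      have hr : ∀ a, p a → ∃ b, (c ∘ σ.symm) a = Sum.inr b := by
        intro a ha
        rcases hb : (c ∘ σ.symm) a with b | b
        · exfalso
          apply ha
          have hmem : ∃ b, c (σ.symm a) = Sum.inl b := ⟨b, hb⟩
          have := (e ⟨σ.symm a, hmem⟩).2
          have h1 : σ (σ.symm a) = e ⟨σ.symm a, hmem⟩ := e.extendSubtype_apply_of_mem _ hmem
          rw [σ.apply_symm_apply] at h1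
          rwa [← h1] at this
        · exact ⟨b, rfl⟩
      choose! d hd using hr
      let r := (Fintype.equivFin {a // p a}).symm
      have hdet := det_fromCols_one_submatrix G p r (fun j => d (r j)) (c ∘ σ.symm) hl
        (fun j => hd _ (r j).2)
      have hperm : v ((fromCols (1 : Matrix ι ι K) G).submatrix id c).det
          = v ((fromCols (1 : Matrix ι ι K) G).submatrix id (c ∘ σ.symm)).det := by
        have := det_permute' σ.symm ((fromCols (1 : Matrix ι ι K) G).submatrix id c)
        rw [submatrix_submatrix, Function.comp_id] at this
        rw [this, valuation_sign_mul]
      rw [hperm, hdet]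
      exact valuation_det_submatrix_le_sup v G (Fintype.card_subtype_le p) _ _
    · obtain ⟨i, j, hij, hne⟩ : ∃ i j, c i = c j ∧ i ≠ j := by
        simpa [Function.Injective] using hc
      rw [det_zero_of_column_eq hne (fun k => by simp [hij]), map_zero]
      exact zero_le
  · rintro ⟨k, r, d⟩ -
    dsimp only
    by_cases hrinj : Function.Injective r
    · let p : ι → Prop := fun i => i ∈ Set.range r
      let e : Fin k ≃ {i // p i} := Equiv.ofInjective r hrinj
      let c : ι → ι ⊕ ι := fun i => if h : p i then Sum.inr (d (e.symm ⟨i, h⟩)) else Sum.inl i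
      have hdet := det_fromCols_one_submatrix G p e d c (fun i hi => dif_neg hi) (fun j => by
        have h1 : c (e j) = Sum.inr (d (e.symm ⟨e j, (e j).2⟩)) := dif_pos (e j).2
        simpa using h1)
      change _ = (G.submatrix r d).det at hdet
      rw [← hdet]
      exact le_maxMinor v _ c
    · obtain ⟨i, j, hij, hne⟩ : ∃ i j, r i = r j ∧ i ≠ j := by
        simpa [Function.Injective] using hrinj
      rw [det_zero_of_row_eq hne (by ext l; simp [hij]), map_zero]
      exact zero_le

/-- Inverting a matrix divides the largest value of its minors by that of its determinant. -/
theorem maxMinor_fromCols_one_inv {H : Matrix ι ι K} (hH : H.det ≠ 0) :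
    maxMinor v (fromCols (1 : Matrix ι ι K) H⁻¹)
      = (v H.det)⁻¹ * maxMinor v (fromCols (1 : Matrix ι ι K) H) := by
  have h1 : fromCols (1 : Matrix ι ι K) H⁻¹ = H⁻¹ * fromCols H (1 : Matrix ι ι K) := by
    rw [mul_fromCols, nonsing_inv_mul _ (isUnit_iff_ne_zero.2 hH), Matrix.mul_one]
  have h2 : fromCols H (1 : Matrix ι ι K)
      = (fromCols (1 : Matrix ι ι K) H).submatrix id (Equiv.sumComm ι ι) := by
    ext i (j | j) <;> simp
  rw [h1, maxMinor_mul_left, h2, maxMinor_submatrix_equiv, det_nonsing_inv, Ring.inverse_eq_inv',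
    map_inv₀]

/-- Adding the identity matrix does not change the largest value of a minor. -/
theorem maxMinor_fromCols_one_one_add (G : Matrix ι ι K) :
    maxMinor v (fromCols (1 : Matrix ι ι K) (1 + G))
      = maxMinor v (fromCols (1 : Matrix ι ι K) G) := by
  have h : fromCols (1 : Matrix ι ι K) (1 + G)
      = fromCols (1 : Matrix ι ι K) G * fromBlocks (1 : Matrix ι ι K) 1 0 (1 : Matrix ι ι K) := by
    simp [fromCols_mul_fromBlocks]
  have h0 := maxMinor_fromCols_one_ne_zero v (1 + G)
  rw [h] at h0 ⊢
  have h1 : ∀ i j, v ((1 : Matrix ι ι K) i j) ≤ 1 := valuation_one_apply_le_one v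
  refine maxMinor_mul_right v (maxMinor_fromCols_one_ne_zero v G) h0
    (U' := fromBlocks 1 (-1) 0 1) (valuation_fromBlocks_one_le_one v h1 h1)
    (valuation_fromBlocks_one_le_one v (fun i j => ?_) h1) ?_
  · rw [Matrix.neg_apply, v.map_neg]; exact h1 i j
  · simp [fromBlocks_multiply]

theorem maxMinor_fromCols_one_neg (G : Matrix ι ι K) :
    maxMinor v (fromCols (1 : Matrix ι ι K) (-G))
      = maxMinor v (fromCols (1 : Matrix ι ι K) G) := by
  have h : fromCols (1 : Matrix ι ι K) (-G)
      = fromCols (1 : Matrix ι ι K) G * fromBlocks (1 : Matrix ι ι K) 0 0 (-1 : Matrix ι ι K) := by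
    simp [fromCols_mul_fromBlocks]
  have h0 := maxMinor_fromCols_one_ne_zero v (-G)
  rw [h] at h0 ⊢
  have h1 : ∀ i j, v (fromBlocks (1 : Matrix ι ι K) 0 0 (-1) i j) ≤ 1 :=
    valuation_fromBlocks_one_le_one v (A := 0) (B := -1) (by simp) fun i j => by
      rw [Matrix.neg_apply, v.map_neg]; exact valuation_one_apply_le_one v i j
  exact maxMinor_mul_right v (maxMinor_fromCols_one_ne_zero v G) h0 h1 h1
    (by simp [fromBlocks_multiply])

/-- The minors of the block matrix with off-diagonal blocks `A` and `B` are products of minors of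
`A` and of `B`. -/
theorem maxMinor_fromCols_one_fromBlocks_antidiagonal (A B : Matrix ι ι K) :
    maxMinor v (fromCols (1 : Matrix (ι ⊕ ι) (ι ⊕ ι) K) (fromBlocks 0 A B 0))
      = maxMinor v (fromCols (1 : Matrix ι ι K) A)
        * maxMinor v (fromCols (1 : Matrix ι ι K) B) := by
  rw [← maxMinor_fromBlocks_diagonal v (maxMinor_fromCols_one_ne_zero v A)
    (maxMinor_fromCols_one_ne_zero v B)]
  have h : fromCols (1 : Matrix (ι ⊕ ι) (ι ⊕ ι) K) (fromBlocks 0 A B 0)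
      = (fromBlocks (fromCols (1 : Matrix ι ι K) A) 0 0 (fromCols (1 : Matrix ι ι K) B)).submatrix
        id ((Equiv.sumCongr (Equiv.refl (ι ⊕ ι)) (Equiv.sumComm ι ι)).trans
          (Equiv.sumSumSumComm ι ι ι ι)) := by
    ext (i | i) ((j | j) | (j | j)) <;> simp [one_apply]
  rw [h, maxMinor_submatrix_equiv]

/-- The largest value of a minor of the closed loop. In terms of orders of poles: the closed loop
has the poles of `P` and of `C` and the zeros of `det (I - P C)`, where poles and zeros are counted
with opposite signs. -/
theorem maxMinor_fromCols_one_closedLoop (P C : Matrix ι ι K) (h : (1 - P * C).det ≠ 0) :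
    maxMinor v (fromCols (1 : Matrix (ι ⊕ ι) (ι ⊕ ι) K) (fromBlocks 1 (-C) (-P) 1)⁻¹)
      = (v (1 - P * C).det)⁻¹ * (maxMinor v (fromCols (1 : Matrix ι ι K) P)
        * maxMinor v (fromCols (1 : Matrix ι ι K) C)) := by
  have hdet : (fromBlocks 1 (-C) (-P) 1).det = (1 - P * C).det := by
    rw [det_fromBlocks_one₁₁, neg_mul_neg]
  have hadd : fromBlocks 1 (-C) (-P) 1 = 1 + fromBlocks 0 (-C) (-P) 0 := by
    rw [← fromBlocks_one, fromBlocks_add]; simp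
  rw [maxMinor_fromCols_one_inv v (hdet ▸ h), hdet, hadd, maxMinor_fromCols_one_one_add,
    maxMinor_fromCols_one_fromBlocks_antidiagonal, maxMinor_fromCols_one_neg,
    maxMinor_fromCols_one_neg, mul_comm (maxMinor v (fromCols 1 C))]

end MaxMinor

end LTI

/-! ### The valuation of real rational functions at a point -/

namespace LTI

open Polynomial WithZero

section PointValuation

/-- The order of vanishing of a real polynomial at a complex number. -/
noncomputable def zeroOrder (p : ℝ[X]) (s : ℂ) : ℕ := (p.map (algebraMap ℝ ℂ)).rootMultiplicity s

theorem map_complex_ne_zero {p : ℝ[X]} (hp : p ≠ 0) : p.map (algebraMap ℝ ℂ) ≠ 0 :=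
  (Polynomial.map_ne_zero_iff (algebraMap ℝ ℂ).injective).2 hp

theorem zeroOrder_mul {p q : ℝ[X]} (hp : p ≠ 0) (hq : q ≠ 0) (s : ℂ) :
    zeroOrder (p * q) s = zeroOrder p s + zeroOrder q s := by
  rw [zeroOrder, Polynomial.map_mul, rootMultiplicity_mul]
  · rfl
  · exact mul_ne_zero (map_complex_ne_zero hp) (map_complex_ne_zero hq)

theorem min_zeroOrder_le {p q : ℝ[X]} (h : p + q ≠ 0) (s : ℂ) :
    min (zeroOrder p s) (zeroOrder q s) ≤ zeroOrder (p + q) s := by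
  have h' := map_complex_ne_zero h
  rw [zeroOrder, zeroOrder, zeroOrder]
  rw [Polynomial.map_add] at h' ⊢
  exact rootMultiplicity_add s h'

theorem zeroOrder_eq_zero_of_eval_ne_zero {p : ℝ[X]} {s : ℂ}
    (h : (p.map (algebraMap ℝ ℂ)).eval s ≠ 0) : zeroOrder p s = 0 :=
  rootMultiplicity_eq_zero h

theorem eval_ne_zero_of_zeroOrder_eq_zero {p : ℝ[X]} {s : ℂ} (hp : p ≠ 0)
    (h : zeroOrder p s = 0) : (p.map (algebraMap ℝ ℂ)).eval s ≠ 0 := fun h0 =>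
  ((rootMultiplicity_pos (map_complex_ne_zero hp)).2 h0).ne' h

open Classical in
/-- The value of a rational function at `s`: `exp k` at a pole of order `k`, `exp (-k)` at a zero of
order `k`, and `0` for the zero function. -/
noncomputable def pointVal (s : ℂ) (f : RatFunc ℝ) : ℤᵐ⁰ :=
  if f = 0 then 0 else exp ((zeroOrder f.denom s : ℤ) - zeroOrder f.num s)

theorem pointVal_div {p q : ℝ[X]} (hp : p ≠ 0) (hq : q ≠ 0) (s : ℂ) :
    pointVal s (algebraMap ℝ[X] (RatFunc ℝ) p / algebraMap ℝ[X] (RatFunc ℝ) q)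
      = exp ((zeroOrder q s : ℤ) - zeroOrder p s) := by
  have hp' := RatFunc.algebraMap_ne_zero hp
  have hq' := RatFunc.algebraMap_ne_zero hq
  set f := algebraMap ℝ[X] (RatFunc ℝ) p / algebraMap ℝ[X] (RatFunc ℝ) q with hf
  have hf0 : f ≠ 0 := div_ne_zero hp' hq'
  have h : f.num * q = p * f.denom := by
    apply RatFunc.algebraMap_injective ℝ
    rw [map_mul, map_mul, ← div_eq_div_iff (RatFunc.algebraMap_ne_zero f.denom_ne_zero) hq',
      RatFunc.num_div_denom]
  have h1 := congrArg (zeroOrder · s) h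
  rw [zeroOrder_mul (RatFunc.num_ne_zero hf0) hq, zeroOrder_mul hp f.denom_ne_zero] at h1
  rw [pointVal, if_neg hf0]
  congr 1
  omega

theorem exists_ratFunc_eq_div {f : RatFunc ℝ} (hf : f ≠ 0) : ∃ p q : ℝ[X], p ≠ 0 ∧ q ≠ 0 ∧
    f = algebraMap ℝ[X] (RatFunc ℝ) p / algebraMap ℝ[X] (RatFunc ℝ) q :=
  ⟨f.num, f.denom, RatFunc.num_ne_zero hf, f.denom_ne_zero, f.num_div_denom.symm⟩

/-- The valuation of the field of real rational functions at a point of the complex plane, written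
multiplicatively: a pole of order `k` has value `exp k`. -/
noncomputable def pointValuation (s : ℂ) : Valuation (RatFunc ℝ) ℤᵐ⁰ where
  toFun := pointVal s
  map_zero' := by simp [pointVal]
  map_one' := by simp [pointVal, zeroOrder, ← Polynomial.C_1, -map_one]
  map_mul' f g := by
    by_cases hf : f = 0
    · simp [hf, pointVal]
    by_cases hg : g = 0
    · simp [hg, pointVal]
    obtain ⟨p, q, hp, hq, rfl⟩ := exists_ratFunc_eq_div hf
    obtain ⟨p', q', hp', hq', rfl⟩ := exists_ratFunc_eq_div hg
    rw [div_mul_div_comm, ← map_mul, ← map_mul, pointVal_div hp hq, pointVal_div hp' hq',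
      pointVal_div (mul_ne_zero hp hp') (mul_ne_zero hq hq'), zeroOrder_mul hp hp',
      zeroOrder_mul hq hq', ← exp_add]
    congr 1
    push_cast
    ring
  map_add_le_max' f g := by
    by_cases hf : f = 0
    · simp [hf]
    by_cases hg : g = 0
    · simp [hg]
    by_cases hfg : f + g = 0
    · simp [hfg, pointVal]
    obtain ⟨p, q, hp, hq, rfl⟩ := exists_ratFunc_eq_div hf
    obtain ⟨p', q', hp', hq', rfl⟩ := exists_ratFunc_eq_div hg
    have hsum : algebraMap ℝ[X] (RatFunc ℝ) p / algebraMap ℝ[X] (RatFunc ℝ) q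
        + algebraMap ℝ[X] (RatFunc ℝ) p' / algebraMap ℝ[X] (RatFunc ℝ) q'
        = algebraMap ℝ[X] (RatFunc ℝ) (p * q' + q * p') / algebraMap ℝ[X] (RatFunc ℝ) (q * q') := by
      rw [div_add_div _ _ (RatFunc.algebraMap_ne_zero hq) (RatFunc.algebraMap_ne_zero hq')]
      simp
    have hn : p * q' + q * p' ≠ 0 := by
      intro h0
      rw [hsum, h0] at hfg
      simp at hfg
    have hmin := min_zeroOrder_le hn s
    rw [zeroOrder_mul hp hq', zeroOrder_mul hq hp'] at hmin
    rw [hsum, pointVal_div hn (mul_ne_zero hq hq'), pointVal_div hp hq, pointVal_div hp' hq',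
      zeroOrder_mul hq hq', le_max_iff, exp_le_exp, exp_le_exp]
    omega

theorem pointValuation_div {p q : ℝ[X]} (hp : p ≠ 0) (hq : q ≠ 0) (s : ℂ) :
    pointValuation s (algebraMap ℝ[X] (RatFunc ℝ) p / algebraMap ℝ[X] (RatFunc ℝ) q)
      = exp ((zeroOrder q s : ℤ) - zeroOrder p s) :=
  pointVal_div hp hq s

/-- Since numerator and denominator are coprime, the value exceeds `1` exactly at the poles, and
there it records the order of the pole. -/
theorem max_one_pointValuation (s : ℂ) (f : RatFunc ℝ) :
    max 1 (pointValuation s f) = exp (poleOrder f s : ℤ) := by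
  have hd : poleOrder f s = zeroOrder f.denom s := rfl
  by_cases hf : f = 0
  · subst hf
    rw [map_zero, max_eq_left zero_le_one, hd]
    simp [zeroOrder, ← Polynomial.C_1, -map_one]
  have hv : pointValuation s f = exp ((zeroOrder f.denom s : ℤ) - zeroOrder f.num s) := if_neg hf
  rw [hv, hd, ← exp_zero]
  have hcop : zeroOrder f.denom s = 0 ∨ zeroOrder f.num s = 0 := by
    by_contra! h
    have h1 := (rootMultiplicity_pos (map_complex_ne_zero f.denom_ne_zero)).1
      (Nat.pos_of_ne_zero h.1)
    have h2 := (rootMultiplicity_pos (map_complex_ne_zero (RatFunc.num_ne_zero hf))).1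
      (Nat.pos_of_ne_zero h.2)
    obtain ⟨a, b, hab⟩ := f.isCoprime_num_denom.map (mapRingHom (algebraMap ℝ ℂ))
    have := congrArg (Polynomial.eval s) hab
    simp only [coe_mapRingHom, eval_add, eval_mul, h1.eq_zero, h2.eq_zero] at this
    simp at this
  rcases hcop with h | h
  · rw [h, max_eq_left]
    · simp
    · rw [exp_le_exp]; omega
  · rw [h, max_eq_right]
    · simp
    · rw [exp_le_exp]; omega

theorem poleOrder_minor_le_poleMult {ι : Type*} [Fintype ι] (G : Matrix ι ι (RatFunc ℝ))
    (x : MinorIndex ι) (s : ℂ) :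
    poleOrder (minor G x) s ≤ poleMult G s :=
  Finset.le_sup (f := fun x : MinorIndex ι => poleOrder (minor G x) s) (Finset.mem_univ x)

/-- The multiplicity of a pole is the largest order of a pole of a minor; the empty minor, of value
`1`, accounts for the points that are not poles. -/
theorem maxMinor_pointValuation {ι : Type*} [Fintype ι] [DecidableEq ι]
    (G : Matrix ι ι (RatFunc ℝ)) (s : ℂ) :
    maxMinor (pointValuation s) (Matrix.fromCols (1 : Matrix ι ι (RatFunc ℝ)) G)
      = exp (poleMult G s : ℤ) := by
  have h1 := one_le_maxMinor_fromCols_one (pointValuation s) G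
  rw [maxMinor_fromCols_one] at h1 ⊢
  refine le_antisymm (Finset.sup_le fun x _ => ?_) ?_
  · refine (le_max_right 1 _).trans ?_
    change max 1 (pointValuation s (minor G x)) ≤ _
    rw [max_one_pointValuation, exp_le_exp]
    exact_mod_cast poleOrder_minor_le_poleMult G x s
  · have hne : (Finset.univ : Finset (MinorIndex ι)).Nonempty :=
      ⟨⟨0, fun i => i.elim0, fun i => i.elim0⟩, Finset.mem_univ _⟩
    obtain ⟨x, -, hx⟩ := Finset.exists_mem_eq_sup _ hne
      (fun x : MinorIndex ι => poleOrder (minor G x) s)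
    have hx' : poleMult G s = poleOrder (minor G x) s := hx
    rw [hx', ← max_one_pointValuation]
    exact max_le h1 (Finset.le_sup
      (f := fun x : MinorIndex ι => pointValuation s (G.submatrix x.2.1 x.2.2).det)
      (Finset.mem_univ x))

/-- If `det (I - P C) = p / q`, then the closed loop has, at each point, the poles of `P` and of
`C`, the zeros of `p`, and the zeros of `q` counted negatively. -/
theorem poleMult_closedLoop_add {m : ℕ} (P C : Matrix (Fin m) (Fin m) (RatFunc ℝ)) {p q : ℝ[X]}
    (hp : p ≠ 0) (hq : q ≠ 0) (h : (1 - P * C).det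
      = algebraMap ℝ[X] (RatFunc ℝ) p / algebraMap ℝ[X] (RatFunc ℝ) q) (s : ℂ) :
    poleMult (closedLoop P C) s + zeroOrder q s
      = poleMult P s + poleMult C s + zeroOrder p s := by
  have h0 : (1 - P * C).det ≠ 0 := h ▸
    div_ne_zero (RatFunc.algebraMap_ne_zero hp) (RatFunc.algebraMap_ne_zero hq)
  have key := maxMinor_fromCols_one_closedLoop (pointValuation s) P C h0
  rw [h, pointValuation_div hp hq, maxMinor_pointValuation, maxMinor_pointValuation,
    maxMinor_pointValuation, ← exp_neg, ← exp_add, ← exp_add, exp_inj] at key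
  change (poleMult (closedLoop P C) s : ℤ) = _ at key
  omega

end PointValuation

end LTI

/-! ### Continuity of the roots of a polynomial -/

namespace LTI

open Polynomial

section RootContinuity

/-- The roots of a polynomial family with continuous coefficients and nonvanishing leading
coefficient stay in a bounded set over a compact parameter interval. -/
theorem exists_bound_roots {q : ℝ → ℂ[X]} {n : ℕ}
    (hcont : ∀ i, Continuous fun τ => (q τ).coeff i)
    (hdeg : ∀ τ ∈ Set.Icc (0 : ℝ) 1, (q τ).natDegree = n)
    (hne : ∀ τ ∈ Set.Icc (0 : ℝ) 1, q τ ≠ 0) :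
    ∃ R : ℝ, 0 ≤ R ∧ ∀ τ ∈ Set.Icc (0 : ℝ) 1, ∀ z, (q τ).IsRoot z → ‖z‖ ≤ R := by
  have hlead : ∀ τ ∈ Set.Icc (0 : ℝ) 1, (q τ).coeff n ≠ 0 := fun τ hτ => by
    rw [← hdeg τ hτ]; exact leadingCoeff_ne_zero.2 (hne τ hτ)
  let f : ℝ → ℝ := fun τ =>
    (∑ i ∈ Finset.range n, ‖(q τ).coeff i‖) / ‖(q τ).coeff n‖ + 1
  have hf : ContinuousOn f (Set.Icc 0 1) := by
    refine ContinuousOn.add (ContinuousOn.div ?_ (hcont n).norm.continuousOn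
      fun τ hτ => norm_ne_zero_iff.2 (hlead τ hτ)) continuousOn_const
    exact (continuous_finsetSum _ fun i _ => (hcont i).norm).continuousOn
  obtain ⟨R, hR⟩ := isCompact_Icc.exists_bound_of_continuousOn hf
  refine ⟨R, (norm_nonneg _).trans (hR 0 (by simp)), fun τ hτ z hz => ?_⟩
  refine le_trans ?_ ((le_abs_self _).trans (hR τ hτ))
  have h1 : ‖z‖ < cauchyBound (q τ) := by exact_mod_cast hz.norm_lt_cauchyBound (hne τ hτ)
  refine h1.le.trans ?_
  rw [cauchyBound, hdeg τ hτ, leadingCoeff, hdeg τ hτ]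
  simp only [f, NNReal.coe_add, NNReal.coe_div, coe_nnnorm, NNReal.coe_one]
  gcongr
  have h2 : (Finset.range n).sup (fun i => ‖(q τ).coeff i‖₊)
      ≤ ∑ i ∈ Finset.range n, ‖(q τ).coeff i‖₊ :=
    Finset.sup_le fun i hi =>
      Finset.single_le_sum (f := fun i => ‖(q τ).coeff i‖₊) (fun _ _ => zero_le) hi
  simpa using NNReal.coe_le_coe.2 h2

theorem exists_enum_roots {p : ℂ[X]} {n : ℕ} (hn : p.natDegree = n) :
    ∃ z : Fin n → ℂ, p.roots = Finset.univ.val.map z := by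
  have hcard : p.roots.toList.length = n := by
    rw [Multiset.length_toList, ← hn]
    exact IsAlgClosed.card_roots_eq_natDegree
  subst hcard
  refine ⟨fun i => p.roots.toList.get i, ?_⟩
  rw [Fin.univ_val_map, List.ofFn_get, Multiset.coe_toList]

theorem roots_eq_of_eval_eq {p : ℂ[X]} {n : ℕ} {c : ℂ} (hc : c ≠ 0) {z : Fin n → ℂ}
    (h : ∀ x, p.eval x = c * ∏ i, (x - z i)) : p.roots = Finset.univ.val.map z := by
  have hp : p = C c * ((Finset.univ.val.map z).map fun a => X - C a).prod := by
    refine Polynomial.funext fun x => ?_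
    rw [h, eval_mul, eval_C, Multiset.map_map]
    congr 1
    change _ = (∏ i, (X - C (z i))).eval x
    simp [eval_prod]
  rw [hp, roots_C_mul _ hc, roots_multiset_prod_X_sub_C]

/-- If the roots of a polynomial family with continuous coefficients and constant degree never
cross the imaginary axis, then the number of roots in the open right half-plane is constant. -/
theorem countP_roots_re_pos_eq {q : ℝ → ℂ[X]} {n : ℕ}
    (hcont : ∀ i, Continuous fun τ => (q τ).coeff i)
    (hdeg : ∀ τ ∈ Set.Icc (0 : ℝ) 1, (q τ).natDegree = n)
    (hne : ∀ τ ∈ Set.Icc (0 : ℝ) 1, q τ ≠ 0)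
    (himag : ∀ τ ∈ Set.Icc (0 : ℝ) 1, ∀ z : ℂ, z.re = 0 → (q τ).eval z ≠ 0) :
    (q 0).roots.countP (fun z => 0 < z.re) = (q 1).roots.countP (fun z => 0 < z.re) := by
  classical
  obtain ⟨R, hR0, hR⟩ := exists_bound_roots hcont hdeg hne
  have hlead : ∀ τ ∈ Set.Icc (0 : ℝ) 1, (q τ).coeff n ≠ 0 := fun τ hτ => by
    rw [← hdeg τ hτ]; exact leadingCoeff_ne_zero.2 (hne τ hτ)
  have hroots : ∀ τ ∈ Set.Icc (0 : ℝ) 1, ∀ z : Fin n → ℂ,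
      (∀ x, (q τ).eval x = (q τ).coeff n * ∏ i, (x - z i)) ↔
        (q τ).roots = Finset.univ.val.map z := by
    intro τ hτ z
    refine ⟨roots_eq_of_eval_eq (hlead τ hτ), fun h x => ?_⟩
    rw [(IsAlgClosed.splits (q τ)).eval_eq_prod_roots, h, leadingCoeff, hdeg τ hτ, Multiset.map_map]
    rfl
  have hcount : ∀ z : Fin n → ℂ, (Finset.univ.val.map z).countP (fun z => 0 < z.re)
      = (Finset.univ.filter fun i => 0 < (z i).re).card := by
    intro z
    rw [Multiset.countP_map]
    rfl
  have hevalcont : ∀ x, Continuous fun τ : Set.Icc (0 : ℝ) 1 => (q τ).eval x := by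
    intro x
    have : (fun τ : Set.Icc (0 : ℝ) 1 => (q τ).eval x)
        = fun τ : Set.Icc (0 : ℝ) 1 => ∑ i ∈ Finset.range (n + 1), (q τ).coeff i * x ^ i := by
      ext τ
      rw [eval_eq_sum_range, hdeg τ τ.2]
    rw [this]
    exact continuous_finsetSum _ fun i _ =>
      ((hcont i).comp continuous_subtype_val).mul continuous_const
  let N : Set.Icc (0 : ℝ) 1 → ℕ := fun τ => (q τ).roots.countP (fun z => 0 < z.re)
  -- the graph of the root tuples whose entries with positive real part are indexed by `S`;
  -- no root is on the imaginary axis, so this is a closed condition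
  let Z : Finset (Fin n) → Set (Set.Icc (0 : ℝ) 1 × (Fin n → ℂ)) := fun S =>
    {a | a.2 ∈ Metric.closedBall 0 R} ∩
    ((⋂ x, {a | (q a.1).eval x = (q a.1).coeff n * ∏ i, (x - a.2 i)}) ∩
      ⋂ i, {a | if i ∈ S then 0 ≤ (a.2 i).re else (a.2 i).re ≤ 0})
  have hZ : ∀ S, IsCompact (Z S) := by
    intro S
    refine IsCompact.of_isClosed_subset (isCompact_univ.prod (isCompact_closedBall 0 R)) ?_
      (t := Z S) (fun a ha => ⟨Set.mem_univ _, ha.1⟩)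
    refine (Metric.isClosed_closedBall.preimage continuous_snd).inter
      ((isClosed_iInter fun x => ?_).inter (isClosed_iInter fun i => ?_))
    · refine isClosed_eq ((hevalcont x).comp continuous_fst) ?_
      exact (((hcont n).comp continuous_subtype_val).comp continuous_fst).mul
        (continuous_finsetProd _ fun i _ =>
          continuous_const.sub ((continuous_apply i).comp continuous_snd))
    · have hre : Continuous fun a : Set.Icc (0 : ℝ) 1 × (Fin n → ℂ) => (a.2 i).re :=
        Complex.continuous_re.comp ((continuous_apply i).comp continuous_snd)
      split_ifs
      · exact isClosed_le continuous_const hre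
      · exact isClosed_le hre continuous_const
  have hN : Continuous N := by
    rw [continuous_iff_isClosed]
    intro T _
    have : N ⁻¹' T = ⋃ S ∈ {S : Finset (Fin n) | S.card ∈ T}, Prod.fst '' Z S := by
      ext τ
      simp only [Set.mem_preimage, Set.mem_iUnion, Set.mem_ofPred_eq, exists_prop]
      constructor
      · intro hτ
        obtain ⟨z, hz⟩ := exists_enum_roots (hdeg τ τ.2)
        refine ⟨Finset.univ.filter fun i => 0 < (z i).re, ?_, (τ, z), ⟨?_, ?_, ?_⟩, rfl⟩
        · rw [← hcount, ← hz]; exact hτ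
        · simp only [Set.mem_ofPred_eq, mem_closedBall_zero_iff]
          refine (pi_norm_le_iff_of_nonneg hR0).2 fun i => hR τ τ.2 _ ?_
          refine (mem_roots (hne τ τ.2)).1 ?_
          rw [hz]
          exact Multiset.mem_map_of_mem z (Finset.mem_univ i)
        · exact Set.mem_iInter.2 fun x => (hroots τ τ.2 z).2 hz x
        · refine Set.mem_iInter.2 fun i => ?_
          simp only [Finset.mem_filter, Finset.mem_univ, true_and, Set.mem_ofPred_eq]
          split_ifs with h
          · exact h.le
          · exact not_lt.1 h
      · rintro ⟨S, hS, ⟨τ', z⟩, ⟨-, h1, h2⟩, rfl⟩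
        have hz := (hroots τ' τ'.2 z).1 (Set.mem_iInter.1 h1)
        have hzne : ∀ i, (z i).re ≠ 0 := by
          intro i h0
          refine himag τ' τ'.2 _ h0 ((mem_roots (hne τ' τ'.2)).1 ?_)
          rw [hz]
          exact Multiset.mem_map_of_mem z (Finset.mem_univ i)
        have hSz : (Finset.univ.filter fun i => 0 < (z i).re) = S := by
          ext i
          have h3 := Set.mem_iInter.1 h2 i
          simp only [Set.mem_ofPred_eq] at h3
          simp only [Finset.mem_filter, Finset.mem_univ, true_and]
          split_ifs at h3 with h
          · exact iff_of_true (lt_of_le_of_ne h3 (hzne i).symm) h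
          · exact iff_of_false (not_lt.2 h3) h
        change (q τ').roots.countP (fun z => 0 < z.re) ∈ T
        rw [hz, hcount, hSz]
        exact hS
    rw [this]
    exact Set.Finite.isClosed_biUnion (Set.toFinite _) fun S _ =>
      ((hZ S).image continuous_fst).isClosed
  exact PreconnectedSpace.constant inferInstance hN
    (x := (⟨0, by simp⟩ : Set.Icc (0 : ℝ) 1)) (y := ⟨1, by simp⟩)

end RootContinuity

end LTI

/-! ### Common denominators, scaled graphs and determinants of polynomial matrices -/

namespace LTI

open Polynomial Matrix

section FrequencyResponse

variable {ι : Type*} [Fintype ι]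

theorem num_mul_eq_mul_denom {f : RatFunc ℝ} {p q : ℝ[X]} (hq : q ≠ 0)
    (h : f = algebraMap ℝ[X] (RatFunc ℝ) p / algebraMap ℝ[X] (RatFunc ℝ) q) :
    f.num * q = p * f.denom := by
  apply RatFunc.algebraMap_injective ℝ
  rw [map_mul, map_mul, ← div_eq_div_iff (RatFunc.algebraMap_ne_zero f.denom_ne_zero)
    (RatFunc.algebraMap_ne_zero hq), RatFunc.num_div_denom, h]

theorem eval_div_of_ne_zero {f : RatFunc ℝ} {p q : ℝ[X]} {s : ℂ}
    (h : f = algebraMap ℝ[X] (RatFunc ℝ) p / algebraMap ℝ[X] (RatFunc ℝ) q)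
    (hs : (q.map (algebraMap ℝ ℂ)).eval s ≠ 0) :
    (q.map (algebraMap ℝ ℂ)).eval s * RatFunc.eval (algebraMap ℝ ℂ) s f
      = (p.map (algebraMap ℝ ℂ)).eval s := by
  have hq : q ≠ 0 := by rintro rfl; simp at hs
  have hdvd : f.denom ∣ q := h ▸ RatFunc.denom_div_dvd p q
  have hd : (f.denom.map (algebraMap ℝ ℂ)).eval s ≠ 0 := by
    obtain ⟨e, he⟩ := hdvd
    intro h0
    rw [he, Polynomial.map_mul, eval_mul, h0, zero_mul] at hs
    exact hs rfl
  have h1 := congrArg (fun r => (r.map (algebraMap ℝ ℂ)).eval s) (num_mul_eq_mul_denom hq h)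
  simp only [Polynomial.map_mul, eval_mul] at h1
  rw [RatFunc.eval, ← eval_map, ← eval_map, mul_div_assoc', div_eq_iff hd, ← h1, mul_comm]

theorem leadingCoeff_mul_valueAtInfty {f : RatFunc ℝ} (hf : f.num.degree ≤ f.denom.degree)
    {p q : ℝ[X]} (hq : q ≠ 0) (hpq : p.natDegree ≤ q.natDegree)
    (h : f = algebraMap ℝ[X] (RatFunc ℝ) p / algebraMap ℝ[X] (RatFunc ℝ) q) :
    q.leadingCoeff * valueAtInfty f = p.coeff q.natDegree := by
  have h1 := congrArg (fun r => r.coeff (f.denom.natDegree + q.natDegree))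
    (num_mul_eq_mul_denom hq h)
  rw [coeff_mul_add_eq_of_natDegree_le (natDegree_le_natDegree hf) le_rfl, add_comm,
    coeff_mul_add_eq_of_natDegree_le hpq le_rfl, f.monic_denom.coeff_natDegree, mul_one] at h1
  rw [valueAtInfty, leadingCoeff, mul_comm, h1]

theorem poleOrder_det_submatrix_le_poleMult (G : Matrix ι ι (RatFunc ℝ)) {k : ℕ}
    (hk : k ≤ Fintype.card ι) (r c : Fin k → ι) (s : ℂ) :
    poleOrder (G.submatrix r c).det s ≤ poleMult G s := by
  have h := poleOrder_minor_le_poleMult G ⟨⟨k, Nat.lt_succ_of_le hk⟩, r, c⟩ s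
  unfold minor at h
  exact h

theorem poleOrder_apply_le_poleMult (G : Matrix ι ι (RatFunc ℝ)) (i j : ι) (s : ℂ) :
    poleOrder (G i j) s ≤ poleMult G s := by
  have h := poleOrder_det_submatrix_le_poleMult G (Fintype.card_pos_iff.2 ⟨i⟩)
    (fun _ : Fin 1 => i) (fun _ => j) s
  rwa [det_fin_one, submatrix_apply] at h

theorem exists_prod_eq_mul (g : ι → ι → ℝ[X]) (i j : ι) :
    ∃ e, ∏ x : ι × ι, g x.1 x.2 = g i j * e :=
  Finset.dvd_prod_of_mem (fun x : ι × ι => g x.1 x.2) (Finset.mem_univ (i, j))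

/-- A transfer matrix in `RL∞` has a common denominator without roots on the imaginary axis, over
which it is proper. -/
theorem IsRLInfty.exists_common_denominator {G : Matrix ι ι (RatFunc ℝ)} (hG : IsRLInfty G) :
    ∃ (d : ℝ[X]) (A : Matrix ι ι ℝ[X]), d ≠ 0 ∧
      (∀ s : ℂ, s.re = 0 → (d.map (algebraMap ℝ ℂ)).eval s ≠ 0) ∧
      (∀ i j, (A i j).natDegree ≤ d.natDegree) ∧
      ∀ i j, G i j = algebraMap ℝ[X] (RatFunc ℝ) (A i j) / algebraMap ℝ[X] (RatFunc ℝ) d := by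
  classical
  let d : ℝ[X] := ∏ x : ι × ι, (G x.1 x.2).denom
  have hd : d ≠ 0 := Finset.prod_ne_zero_iff.2 fun x _ => RatFunc.denom_ne_zero _
  have hdvd : ∀ i j, ∃ e, d = (G i j).denom * e :=
    exists_prod_eq_mul fun i j => (G i j).denom
  choose e he using hdvd
  have he0 : ∀ i j, e i j ≠ 0 := fun i j h => hd (by rw [he i j, h, mul_zero])
  refine ⟨d, Matrix.of fun i j => (G i j).num * e i j, hd, fun s hs => ?_, fun i j => ?_,
    fun i j => ?_⟩
  · rw [Polynomial.map_prod, eval_prod]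
    refine Finset.prod_ne_zero_iff.2 fun x _ => ?_
    refine eval_ne_zero_of_zeroOrder_eq_zero (RatFunc.denom_ne_zero _) ?_
    exact Nat.le_zero.1 ((poleOrder_apply_le_poleMult G x.1 x.2 s).trans (hG.2 s hs).le)
  · rw [he i j, natDegree_mul (RatFunc.denom_ne_zero _) (he0 i j)]
    exact natDegree_mul_le.trans (Nat.add_le_add_right (natDegree_le_natDegree (hG.1 i j)) _)
  · rw [of_apply, he i j, map_mul, map_mul, mul_div_mul_right _ _
      (RatFunc.algebraMap_ne_zero (he0 i j)), RatFunc.num_div_denom]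

end FrequencyResponse

section ScaledGraph

variable {m : ℕ}

/-- If `τ P C` fixes a nonzero vector `u`, then `x = C u` is mapped by `τ P` to `u`, so that the
pair `(x, u)` gives a common point of the scaled graph of `τ P` and the inverse scaled graph of
`C`. -/
theorem det_one_sub_ne_zero_of_disjoint {A B : Matrix (Fin m) (Fin m) ℂ} {t : ℂ}
    (h : scaledGraph (t • A) ∩ invScaledGraph B = ∅) : (1 - t • (A * B)).det ≠ 0 := by
  intro h0
  obtain ⟨y, hy, hAy⟩ := exists_mulVec_eq_zero_iff.2 h0
  set u : EuclideanSpace ℂ (Fin m) := WithLp.toLp 2 y with hu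
  have hu0 : u ≠ 0 := fun h => hy (by simpa [hu] using h)
  have hfix : LTI.apply (t • A) (LTI.apply B u) = u := by
    rw [sub_mulVec, one_mulVec, sub_eq_zero, ← smul_mul_assoc, ← mulVec_mulVec] at hAy
    simp only [LTI.apply, hu]
    rw [← hAy]
  have hx0 : LTI.apply B u ≠ 0 := by
    intro hx
    apply hu0
    rw [← hfix, hx]
    simp [LTI.apply]
  have hmem : (gain (LTI.apply B u) u * Complex.exp (Complex.I * phase (LTI.apply B u) u) : ℂ)
      ∈ scaledGraph (t • A) ∩ invScaledGraph B :=
    ⟨⟨LTI.apply B u, hx0, by rwa [hfix], Or.inl (by rw [hfix])⟩, ⟨u, hu0, hx0, Or.inl rfl⟩⟩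
  rw [h] at hmem
  exact hmem

end ScaledGraph

section Homotopy

theorem continuous_coeff_sum {α : Type*} (s : Finset α) {f : α → ℝ → ℝ[X]}
    (h : ∀ a ∈ s, ∀ i, Continuous fun τ => (f a τ).coeff i) (i : ℕ) :
    Continuous fun τ => (∑ a ∈ s, f a τ).coeff i := by
  simp only [finsetSum_coeff]
  exact continuous_finsetSum _ fun a ha => h a ha i

theorem continuous_coeff_mul {f g : ℝ → ℝ[X]} (hf : ∀ i, Continuous fun τ => (f τ).coeff i)
    (hg : ∀ i, Continuous fun τ => (g τ).coeff i) (i : ℕ) :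
    Continuous fun τ => (f τ * g τ).coeff i := by
  simp only [coeff_mul]
  exact continuous_finsetSum _ fun a _ => (hf _).mul (hg _)

theorem continuous_coeff_prod {α : Type*} (s : Finset α) {f : α → ℝ → ℝ[X]}
    (h : ∀ a ∈ s, ∀ i, Continuous fun τ => (f a τ).coeff i) (i : ℕ) :
    Continuous fun τ => (∏ a ∈ s, f a τ).coeff i := by
  classical
  induction s using Finset.induction_on generalizing i with
  | empty => simpa using continuous_const
  | insert a s ha ih =>
    simp only [Finset.prod_insert ha]
    exact continuous_coeff_mul (h a (Finset.mem_insert_self a s))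
      (ih fun b hb => h b (Finset.mem_insert_of_mem hb)) i

theorem continuous_coeff_det {ι : Type*} [Fintype ι] [DecidableEq ι] {M : ℝ → Matrix ι ι ℝ[X]}
    (h : ∀ a b i, Continuous fun τ => (M τ a b).coeff i) (i : ℕ) :
    Continuous fun τ => (M τ).det.coeff i := by
  simp only [det_apply']
  refine continuous_coeff_sum _ (f := fun σ τ =>
    ((Equiv.Perm.sign σ : ℤ) : ℝ[X]) * ∏ a, M τ (σ a) a) (fun σ _ => ?_) i
  exact continuous_coeff_mul (f := fun _ => ((Equiv.Perm.sign σ : ℤ) : ℝ[X]))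
    (fun _ => continuous_const)
    (continuous_coeff_prod _ (f := fun a τ => M τ (σ a) a) fun a _ => h _ _)

theorem natDegree_det_le {ι : Type*} [Fintype ι] [DecidableEq ι] {M : Matrix ι ι ℝ[X]} {k : ℕ}
    (h : ∀ i j, (M i j).natDegree ≤ k) : M.det.natDegree ≤ Fintype.card ι * k := by
  rw [det_apply]
  refine natDegree_sum_le_of_forall_le _ _ fun σ _ => ?_
  refine (natDegree_smul_le _ _).trans ((natDegree_prod_le _ _).trans ?_)
  exact (Finset.sum_le_card_nsmul _ _ k fun i _ => h _ _).trans (by simp)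

/-- The top coefficient of a determinant is the determinant of the top coefficients. -/
theorem coeff_det_of_natDegree_le {ι : Type*} [Fintype ι] [DecidableEq ι] {M : Matrix ι ι ℝ[X]}
    {k : ℕ} (h : ∀ i j, (M i j).natDegree ≤ k) :
    M.det.coeff (Fintype.card ι * k) = (M.map fun p => p.coeff k).det := by
  rw [det_apply, det_apply, finsetSum_coeff]
  refine Finset.sum_congr rfl fun σ _ => ?_
  have := coeff_prod_of_natDegree_le (s := Finset.univ) (fun i => M (σ i) i) k fun i _ => h _ _
  rw [Finset.card_univ] at this
  rcases Int.units_eq_one_or (Equiv.Perm.sign σ) with hs | hs <;>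
    simp [hs, Units.smul_def, this]

theorem det_smul_one_sub_smul_mul {R ι : Type*} [CommRing R] [Fintype ι] [DecidableEq ι]
    (a b t : R) (P C : Matrix ι ι R) :
    ((a * b) • (1 : Matrix ι ι R) - t • ((a • P) * (b • C))).det
      = (a * b) ^ Fintype.card ι * (1 - t • (P * C)).det := by
  rw [← det_smul, smul_sub, Matrix.smul_mul, Matrix.mul_smul, smul_smul a b,
    smul_comm t (a * b)]

end Homotopy

end LTI

/-! ### Counting the poles of the closed loop -/

namespace LTI

open Polynomial Matrix WithZero

section Counting

theorem finsum_mem_openRHP_zeroOrder (p : ℝ[X]) :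
    ∑ᶠ s ∈ openRHP, zeroOrder p s
      = (p.map (algebraMap ℝ ℂ)).roots.countP (fun z => 0 < z.re) := by
  classical
  set r := (p.map (algebraMap ℝ ℂ)).roots with hr
  have hz : ∀ s, zeroOrder p s = r.count s := fun s => (count_roots _).symm
  have h1 : ∀ s, (∑ᶠ (_ : s ∈ openRHP), zeroOrder p s)
      = (r.filter fun z => 0 < z.re).count s := by
    intro s
    rw [Multiset.count_filter, ← hz, finsum_eq_if]
    rfl
  rw [finsum_congr h1, finsum_eq_sum_of_support_subset (s := r.toFinset),
    Multiset.countP_eq_card_filter]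
  · refine Multiset.sum_count_eq_card fun a ha => ?_
    exact Multiset.mem_toFinset.2 (Multiset.mem_of_mem_filter ha)
  · intro s hs
    have := Multiset.count_pos.1 (Nat.pos_of_ne_zero hs)
    exact Finset.mem_coe.2 (Multiset.mem_toFinset.2 (Multiset.mem_of_mem_filter this))

theorem finite_support_zeroOrder (p : ℝ[X]) :
    (Function.support (zeroOrder p)).Finite := by
  classical
  refine ((p.map (algebraMap ℝ ℂ)).roots.toFinset.finite_toSet).subset fun s hs => ?_
  refine Finset.mem_coe.2 (Multiset.mem_toFinset.2 ?_)
  rw [← Multiset.count_pos, count_roots]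
  exact Nat.pos_of_ne_zero hs

/-- Summing local multiplicities over the open right half-plane. -/
theorem numPoles_closedLoop_add {m : ℕ} {P C : Matrix (Fin m) (Fin m) (RatFunc ℝ)} {p q : ℝ[X]}
    (h : ∀ s, poleMult (closedLoop P C) s + zeroOrder q s
      = poleMult P s + poleMult C s + zeroOrder p s) :
    numPoles (closedLoop P C) openRHP
        + (q.map (algebraMap ℝ ℂ)).roots.countP (fun z => 0 < z.re)
      = numPoles P openRHP + numPoles C openRHP
        + (p.map (algebraMap ℝ ℂ)).roots.countP (fun z => 0 < z.re) := by
  have fin : ∀ {f : ℂ → ℕ}, (Function.support f).Finite → (openRHP ∩ Function.support f).Finite :=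
    fun hf => hf.subset Set.inter_subset_right
  rw [← finsum_mem_openRHP_zeroOrder p, ← finsum_mem_openRHP_zeroOrder q, numPoles, numPoles,
    numPoles,
    ← finsum_mem_add_distrib' (fin (finite_support_poleMult _)) (fin (finite_support_zeroOrder q)),
    ← finsum_mem_add_distrib' (fin (finite_support_poleMult _)) (fin (finite_support_poleMult _)),
    ← finsum_mem_add_distrib' (fin _) (fin (finite_support_zeroOrder p))]
  · exact finsum_mem_congr rfl fun s _ => h s
  · refine ((finite_support_poleMult P).union (finite_support_poleMult C)).subset ?_
    exact Function.support_add _ _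

end Counting

section Proper

theorem inftyValuation_le_one_iff [DecidableEq (RatFunc ℝ)] {f : RatFunc ℝ} :
    RatFunc.inftyValuation ℝ f ≤ 1 ↔ f.num.degree ≤ f.denom.degree := by
  by_cases hf : f = 0
  · simp [hf]
  · rw [RatFunc.inftyValuation_apply, RatFunc.inftyValuation_of_nonzero ℝ hf, ← exp_zero,
      exp_le_exp,
      RatFunc.intDegree, degree_eq_natDegree (RatFunc.num_ne_zero hf),
      degree_eq_natDegree f.denom_ne_zero, Nat.cast_le]
    omega

/-- The closed loop is proper if `det (I - P C)` is a quotient of polynomials of equal degree. -/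
theorem isProper_closedLoop {m : ℕ} {P C : Matrix (Fin m) (Fin m) (RatFunc ℝ)} {p q : ℝ[X]}
    (hP : IsProper P) (hC : IsProper C) (hp : p ≠ 0) (hq : q ≠ 0)
    (hdeg : p.natDegree = q.natDegree) (h : (1 - P * C).det
      = algebraMap ℝ[X] (RatFunc ℝ) p / algebraMap ℝ[X] (RatFunc ℝ) q) :
    IsProper (closedLoop P C) := by
  classical
  intro i j
  rw [← inftyValuation_le_one_iff]
  set v := RatFunc.inftyValuation ℝ
  have hH : ∀ i j, v (fromBlocks 1 (-C) (-P) 1 i j) ≤ 1 := by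
    rintro (i | i) (j | j)
    · exact valuation_one_apply_le_one v i j
    · simpa using inftyValuation_le_one_iff.2 (hC i j)
    · simpa using inftyValuation_le_one_iff.2 (hP i j)
    · exact valuation_one_apply_le_one v i j
  have hdet : v (fromBlocks 1 (-C) (-P) 1).det = 1 := by
    rw [det_fromBlocks_one₁₁, neg_mul_neg, h, map_div₀, RatFunc.inftyValuation_apply,
      RatFunc.inftyValuation_apply, RatFunc.inftyValuation.polynomial ℝ hp,
      RatFunc.inftyValuation.polynomial ℝ hq, hdeg, div_self exp_ne_zero]
  rw [closedLoop, inv_def, Ring.inverse_eq_inv', Matrix.smul_apply, smul_eq_mul, map_mul, map_inv₀,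
    hdet, inv_one, one_mul, adjugate_apply]
  refine valuation_det_le_one v fun a b => ?_
  by_cases ha : a = j
  · subst ha
    rw [updateRow_self, Pi.single_apply]
    split_ifs <;> simp
  · rw [updateRow_ne ha]
    exact hH a b

end Proper

section HomotopyPolynomial

variable {ι : Type*} [Fintype ι] [DecidableEq ι]

/-- The numerator of `det (I - τ P C)` over a common denominator, for `P = A / a` and
`C = B / b`. -/
noncomputable def loopNumerator (a b : ℝ[X]) (A B : Matrix ι ι ℝ[X]) (τ : ℝ) : ℝ[X] :=
  ((a * b) • (1 : Matrix ι ι ℝ[X]) - C τ • (A * B)).det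

variable {a b : ℝ[X]} {A B : Matrix ι ι ℝ[X]}

theorem continuous_coeff_loopNumerator (i : ℕ) :
    Continuous fun τ => (loopNumerator a b A B τ).coeff i := by
  refine continuous_coeff_det (fun x y i => ?_) i
  simp only [Matrix.sub_apply, Matrix.smul_apply, smul_eq_mul, coeff_sub, coeff_C_mul]
  exact continuous_const.sub (continuous_id.mul continuous_const)

theorem loopNumerator_zero : loopNumerator a b A B 0 = (a * b) ^ Fintype.card ι := by
  simp [loopNumerator]

/-- A ring homomorphism that carries `A` and `B` to multiples of `P` and `C` carries the loop
numerator to a multiple of `det (I - τ P C)`. -/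
theorem map_loopNumerator {R : Type*} [CommRing R] (φ : ℝ[X] →+* R) {P Q : Matrix ι ι R}
    (hA : ∀ i j, φ (A i j) = φ a * P i j) (hB : ∀ i j, φ (B i j) = φ b * Q i j) (τ : ℝ) :
    φ (loopNumerator a b A B τ)
      = (φ a * φ b) ^ Fintype.card ι * (1 - φ (C τ) • (P * Q)).det := by
  have hA' : φ.mapMatrix A = φ a • P := by ext i j; simp [hA]
  have hB' : φ.mapMatrix B = φ b • Q := by ext i j; simp [hB]
  have hs : ∀ (r : ℝ[X]) (M : Matrix ι ι ℝ[X]), φ.mapMatrix (r • M) = φ r • φ.mapMatrix M := by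
    intro r M; ext i j; simp
  rw [loopNumerator, RingHom.map_det, map_sub, hs, hs, map_mul φ.mapMatrix, hA', hB', map_one,
    map_mul, det_smul_one_sub_smul_mul]

theorem natDegree_loop_entry_le (hA : ∀ i j, (A i j).natDegree ≤ a.natDegree)
    (hB : ∀ i j, (B i j).natDegree ≤ b.natDegree) (τ : ℝ) (i j : ι) :
    (((a * b) • (1 : Matrix ι ι ℝ[X]) - C τ • (A * B)) i j).natDegree
      ≤ a.natDegree + b.natDegree := by
  rw [Matrix.sub_apply, Matrix.smul_apply, Matrix.smul_apply, smul_eq_mul, smul_eq_mul]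
  refine (natDegree_sub_le _ _).trans (max_le ?_ ?_)
  · rw [one_apply]
    split_ifs
    · rw [mul_one]; exact natDegree_mul_le
    · simp
  · refine (natDegree_C_mul_le _ _).trans ?_
    rw [mul_apply]
    exact natDegree_sum_le_of_forall_le _ _ fun k _ =>
      natDegree_mul_le.trans (add_le_add (hA _ _) (hB _ _))

theorem natDegree_loopNumerator_le (hA : ∀ i j, (A i j).natDegree ≤ a.natDegree)
    (hB : ∀ i j, (B i j).natDegree ≤ b.natDegree) (τ : ℝ) :
    (loopNumerator a b A B τ).natDegree
      ≤ Fintype.card ι * (a.natDegree + b.natDegree) :=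
  natDegree_det_le (natDegree_loop_entry_le hA hB τ)

/-- The top coefficient of the loop numerator is a multiple of `det (I - τ P(∞) C(∞))`. -/
theorem coeff_loopNumerator (hA : ∀ i j, (A i j).natDegree ≤ a.natDegree)
    (hB : ∀ i j, (B i j).natDegree ≤ b.natDegree) {P Q : Matrix ι ι ℝ}
    (hP : ∀ i j, a.leadingCoeff * P i j = (A i j).coeff a.natDegree)
    (hQ : ∀ i j, b.leadingCoeff * Q i j = (B i j).coeff b.natDegree) (τ : ℝ) :
    (loopNumerator a b A B τ).coeff (Fintype.card ι * (a.natDegree + b.natDegree))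
      = (a.leadingCoeff * b.leadingCoeff) ^ Fintype.card ι * (1 - τ • (P * Q)).det := by
  rw [loopNumerator, coeff_det_of_natDegree_le (natDegree_loop_entry_le hA hB τ),
    ← det_smul_one_sub_smul_mul]
  congr 1
  ext i j
  have h1 : ((A * B) i j).coeff (a.natDegree + b.natDegree)
      = ((a.leadingCoeff • P) * (b.leadingCoeff • Q)) i j := by
    rw [mul_apply, mul_apply, finsetSum_coeff]
    refine Finset.sum_congr rfl fun k _ => ?_
    rw [coeff_mul_add_eq_of_natDegree_le (hA _ _) (hB _ _), Matrix.smul_apply, Matrix.smul_apply,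
      smul_eq_mul, smul_eq_mul, hP, hQ]
  rw [Matrix.map_apply, Matrix.sub_apply, Matrix.smul_apply, Matrix.smul_apply, smul_eq_mul,
    smul_eq_mul, coeff_sub, coeff_C_mul, h1, Matrix.sub_apply, Matrix.smul_apply, Matrix.smul_apply,
    smul_eq_mul, smul_eq_mul]
  congr 1
  rw [one_apply, one_apply]
  split_ifs
  · rw [mul_one, mul_one, coeff_mul_add_eq_of_natDegree_le le_rfl le_rfl]; rfl
  · simp

end HomotopyPolynomial

section Feedback

variable {m : ℕ} {P C : Matrix (Fin m) (Fin m) (RatFunc ℝ)}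

theorem freqResp_top_eq_map (G : Matrix (Fin m) (Fin m) (RatFunc ℝ)) :
    freqResp G ⊤ = (Matrix.of fun i j => valueAtInfty (G i j)).map (algebraMap ℝ ℂ) := by
  ext i j; rfl

/-- If `det (I - τ P C)` has no zero on the extended imaginary axis for `τ ∈ [0, 1]`, then the
zeros of its numerator in the open right half-plane are as many for `τ = 1` as for `τ = 0`, where
they are the zeros of the denominator. -/
theorem isFeedbackDominant_of_det_ne_zero {p₁ p₂ : ℕ} (hP : IsDominant P p₁)
    (hC : IsDominant C p₂)
    (hdet : ∀ ω : EReal, ∀ τ ∈ Set.Icc (0 : ℝ) 1,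
      (1 - (τ : ℂ) • (freqResp P ω * freqResp C ω)).det ≠ 0) :
    IsFeedbackDominant P C (p₁ + p₂) := by
  obtain ⟨a, A, ha, haI, hA, hPA⟩ := hP.1.exists_common_denominator
  obtain ⟨b, B, hb, hbI, hB, hCB⟩ := hC.1.exists_common_denominator
  have hwell : IsWellPosed P C := by
    have h := hdet ⊤ 1 (by simp)
    rw [Complex.ofReal_one, one_smul] at h
    exact (isUnit_iff_isUnit_det _).2 (isUnit_iff_ne_zero.2 h)
  -- the loop numerator keeps its degree because the loop is well-posed for all `τ`
  have htop : ∀ τ ∈ Set.Icc (0 : ℝ) 1, (loopNumerator a b A B τ).coeff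
      (Fintype.card (Fin m) * (a.natDegree + b.natDegree)) ≠ 0 := by
    intro τ hτ
    rw [coeff_loopNumerator hA hB
      (P := Matrix.of fun i j => valueAtInfty (P i j))
      (Q := Matrix.of fun i j => valueAtInfty (C i j))
      (fun i j => leadingCoeff_mul_valueAtInfty (hP.1.1 i j) ha (hA i j) (hPA i j))
      (fun i j => leadingCoeff_mul_valueAtInfty (hC.1.1 i j) hb (hB i j) (hCB i j))]
    refine mul_ne_zero (pow_ne_zero _ (mul_ne_zero (leadingCoeff_ne_zero.2 ha)
      (leadingCoeff_ne_zero.2 hb))) fun h0 => hdet ⊤ τ hτ ?_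
    have h1 := congrArg (algebraMap ℝ ℂ) h0
    rw [map_zero, RingHom.map_det, map_sub, map_one] at h1
    rw [← h1, freqResp_top_eq_map, freqResp_top_eq_map]
    congr 2
    ext i j
    simp [mul_apply]
  have hdeg : ∀ τ ∈ Set.Icc (0 : ℝ) 1, (loopNumerator a b A B τ).natDegree
      = Fintype.card (Fin m) * (a.natDegree + b.natDegree) := fun τ hτ =>
    natDegree_eq_of_le_of_coeff_ne_zero (natDegree_loopNumerator_le hA hB τ) (htop τ hτ)
  have hne : ∀ τ ∈ Set.Icc (0 : ℝ) 1, loopNumerator a b A B τ ≠ 0 := by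
    intro τ hτ h0
    exact htop τ hτ (by rw [h0, coeff_zero])
  have himag : ∀ τ ∈ Set.Icc (0 : ℝ) 1, ∀ s : ℂ, s.re = 0 →
      ((loopNumerator a b A B τ).map (algebraMap ℝ ℂ)).eval s ≠ 0 := by
    intro τ hτ s hs
    have hω : s = Complex.I * (s.im : ℂ) := by
      apply Complex.ext <;> simp [hs]
    have hresp : ∀ (G : Matrix (Fin m) (Fin m) (RatFunc ℝ)) (i j : Fin m),
        freqResp G (s.im : EReal) i j = RatFunc.eval (algebraMap ℝ ℂ) s (G i j) := fun G i j =>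
      (congrArg (fun z => RatFunc.eval (algebraMap ℝ ℂ) z (G i j)) hω).symm
    have hA' : ∀ i j, ((A i j).map (algebraMap ℝ ℂ)).eval s
        = (a.map (algebraMap ℝ ℂ)).eval s * freqResp P (s.im : EReal) i j := by
      intro i j
      rw [← eval_div_of_ne_zero (hPA i j) (haI s hs), hresp P i j]
    have hB' : ∀ i j, ((B i j).map (algebraMap ℝ ℂ)).eval s
        = (b.map (algebraMap ℝ ℂ)).eval s * freqResp C (s.im : EReal) i j := by
      intro i j
      rw [← eval_div_of_ne_zero (hCB i j) (hbI s hs), hresp C i j]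
    have key := map_loopNumerator ((evalRingHom s).comp (mapRingHom (algebraMap ℝ ℂ))) hA' hB' τ
    simp only [RingHom.comp_apply, coe_mapRingHom, coe_evalRingHom, map_C, eval_C] at key
    rw [key]
    exact mul_ne_zero (pow_ne_zero _ (mul_ne_zero (haI s hs) (hbI s hs))) (hdet _ τ hτ)
  have hcount := countP_roots_re_pos_eq
    (q := fun τ => (loopNumerator a b A B τ).map (algebraMap ℝ ℂ))
    (n := Fintype.card (Fin m) * (a.natDegree + b.natDegree))
    (fun i => by
      simp only [coeff_map]
      exact Complex.continuous_ofReal.comp (continuous_coeff_loopNumerator i))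
    (fun τ hτ => by rw [natDegree_map, hdeg τ hτ])
    (fun τ hτ => map_complex_ne_zero (hne τ hτ)) himag
  have h0mem : (0 : ℝ) ∈ Set.Icc (0 : ℝ) 1 := by simp
  have h1mem : (1 : ℝ) ∈ Set.Icc (0 : ℝ) 1 := by simp
  have hloop : (1 - P * C).det
      = algebraMap ℝ[X] (RatFunc ℝ) (loopNumerator a b A B 1)
        / algebraMap ℝ[X] (RatFunc ℝ) (loopNumerator a b A B 0) := by
    have ha' := RatFunc.algebraMap_ne_zero ha
    have hb' := RatFunc.algebraMap_ne_zero hb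
    have key := map_loopNumerator (algebraMap ℝ[X] (RatFunc ℝ)) (A := A) (B := B) (P := P) (Q := C)
      (fun i j => by rw [hPA i j, mul_div_cancel₀ _ ha'])
      (fun i j => by rw [hCB i j, mul_div_cancel₀ _ hb']) 1
    rw [key, loopNumerator_zero, map_pow, map_mul, map_one, map_one, one_smul,
      mul_div_cancel_left₀ _ (pow_ne_zero _ (mul_ne_zero ha' hb'))]
  have hmult := poleMult_closedLoop_add P C (hne 1 h1mem) (hne 0 h0mem) hloop
  refine ⟨hwell, ⟨isProper_closedLoop hP.1.1 hC.1.1 (hne 1 h1mem) (hne 0 h0mem)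
    ((hdeg 1 h1mem).trans (hdeg 0 h0mem).symm) hloop, fun s hs => ?_⟩, ?_⟩
  · have h := hmult s
    rw [hP.1.2 s hs, hC.1.2 s hs, zeroOrder_eq_zero_of_eval_ne_zero (himag 1 h1mem s hs)] at h
    omega
  · have h := numPoles_closedLoop_add hmult
    rw [hP.2, hC.2, ← hcount] at h
    exact Nat.add_right_cancel h

end Feedback

end LTI

theorem mainTheorem1 (m : ℕ) (P C : Matrix (Fin m) (Fin m) (RatFunc ℝ)) (p₁ p₂ : ℕ)
    (hP : LTI.IsDominant P p₁) (hC : LTI.IsDominant C p₂)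
    (hPC : LTI.NoUnstableCancellation P C)
    (hSG : ∀ ω : EReal, ∀ τ : ℝ, τ ∈ Set.Ioc (0 : ℝ) 1 →
      LTI.scaledGraph ((τ : ℂ) • LTI.freqResp P ω) ∩
        LTI.invScaledGraph (LTI.freqResp C ω) = ∅) :
    LTI.IsFeedbackDominant P C (p₁ + p₂) := by
  refine LTI.isFeedbackDominant_of_det_ne_zero hP hC fun ω τ hτ => ?_
  rcases hτ.1.eq_or_lt with h0 | h0
  · simp [← h0]
  · exact LTI.det_one_sub_ne_zero_of_disjoint (hSG ω τ ⟨h0, hτ.2⟩)
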